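/- Let $N_w, N_b > 0$ and $\delta \in (0,1)$. For $N>0$ and $\mathbf{x} \in \mathbb{R}^n$, let $W_N^{\otimes n}(\cdot|\mathbf{x})$ denote the law of $(x_i + G_i)_{i=1}^n$ with $G_1,\dots,G_n$ i.i.d. $\mathcal{N}(0,N/2)$; the legitimate receiver's channel has $N = N_b$ and the warden's channel has $N = N_w$. A code of blocklength $n$ consists of integers $M, K \ge 1$ (numbers of messages and of keys), codewords $\mathbf{x}_{ms} \in \mathbb{R}^n$ for $1\le m\le M$, $1\le s\le K$, and a measurable decoder $\Gamma(\cdot,s)$ for every key $s$, which maps $\mathbf{y} \in \mathbb{R}^n$ to a message in $\{0,1,\dots,M\}$ or to a declared error; the message $0$ stands for "no transmission", in which case the channel input is $\mathbf{0}$. Its probability of error is $$P_{\mathrm{err}} = \max_{1\le s\le K} \frac1M \sum_{m=1}^M W_{N_b}^{\otimes n}\big(\Gamma(\mathbf{Y},s) \ne m \,\big|\, \mathbf{x}_{ms}\big) + \frac1K\sum_{s=1}^K W_{N_b}^{\otimes n}\big(\Gamma(\mathbf{Y},s) \ne 0 \,\big|\, \mathbf{0}\big).$$ Let $\widehat{Q}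 = \frac{1}{MK}\sum_{m=1}^M\sum_{s=1}^K W_{N_w}^{\otimes n}(\cdot|\mathbf{x}_{ms})$ and $Q_0^{\otimes n} = W_{N_w}^{\otimes n}(\cdot|\mathbf{0})$ be the laws of the warden's observation with and without transmission. Theorem 4. For any sequence of codes whose blocklengths $n$ tend to infinity, if $\lim_{n\to\infty} P_{\mathrm{err}} = 0$ and $\limsup_{n\to\infty} \mathbb{D}(\widehat{Q} \,\|\, Q_0^{\otimes n}) \le \delta$, where $\mathbb{D}$ is the Kullback-Leibler divergence and logarithms are natural, then $$\limsup_{n\to\infty} \frac{\log M}{\sqrt{n}} \le \frac{\sqrt{\delta}\, N_w}{N_b}.$$ -/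

import Mathlib

open MeasureTheory ProbabilityTheory InformationTheory Filter Topology
open scoped ENNReal NNReal

namespace CovertComm

noncomputable section

/-- The output law of `n` uses of the memoryless channel `Y_i = x_i + B_i`, where the `B_i` are
i.i.d. `𝒩(0, N / 2)`, when the channel input is `x`. -/
def channelLaw (N : ℝ) {n : ℕ} (x : Fin n → ℝ) : Measure (Fin n → ℝ) :=
  Measure.pi fun i => gaussianReal (x i) (N / 2).toNNReal

/-- A code of blocklength `n` with `M` messages and `K` keys. The message `0` stands for "no
transmission"; the element `m : Fin M` is the message `m + 1`, that is, `m.succ : Fin (M + 1)`.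
The decoder sees the channel output and the key and returns a message in `{0, 1, …, M}`, or `none`
(declared error). -/
structure Code (n : ℕ) where
  M : ℕ
  K : ℕ
  M_pos : 0 < M
  K_pos : 0 < K
  /-- The codeword `codeword m s` of the message-key pair `(m, s)`, with arbitrary real entries. -/
  codeword : Fin M → Fin K → Fin n → ℝ
  /-- The decoder, with its decoding regions measurable. -/
  decoder : Fin K → (Fin n → ℝ) → Option (Fin (M + 1))
  measurableSet_decoder : ∀ s o, MeasurableSet {y | decoder s y = o}

namespace Code

variable {n : ℕ} (C : Code n)

/-- The probability that the decoded message differs from the sent one, given that the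
transmitter is active and that the key is `s`, the message being uniform. -/
def messageError (Nb : ℝ) (s : Fin C.K) : ℝ :=
  (1 / (C.M : ℝ)) *
    ∑ m : Fin C.M, (channelLaw Nb (C.codeword m s)).real {y | C.decoder s y ≠ some m.succ}

/-- The probability that the decoder does not return `0`, given that the transmitter is silent
(the channel input is zero), the key being uniform. -/
def silenceError (Nb : ℝ) : ℝ :=
  (1 / (C.K : ℝ)) *
    ∑ s : Fin C.K, (channelLaw Nb (0 : Fin n → ℝ)).real {y | C.decoder s y ≠ some 0}

/-- The max-average probability of error: maximized over the key, averaged over the message, plus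
the probability of error when the transmitter is silent. -/
def errorProb (Nb : ℝ) : ℝ :=
  (⨆ s : Fin C.K, C.messageError Nb s) + C.silenceError Nb

/-- The law of the warden's observation when the transmitter is active, the message and the key
being uniform and independent. -/
def wardenLaw (Nw : ℝ) : Measure (Fin n → ℝ) :=
  ((C.M : ℝ≥0∞) * (C.K : ℝ≥0∞))⁻¹ •
    ∑ m : Fin C.M, ∑ s : Fin C.K, channelLaw Nw (C.codeword m s)

end Code

/-- The law `Q₀^{⊗n}` of the warden's observation when the transmitter is silent. -/
def silentLaw (Nw : ℝ) (n : ℕ) : Measure (Fin n → ℝ) :=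
  channelLaw Nw (0 : Fin n → ℝ)

end

end CovertComm

namespace CovertComm

/-! Both receivers constrain one quantity, the average energy `E` of the codewords. For the
legitimate receiver, `log M (1 - P_err) ≤ E / Nb + 1`: a Fano argument that compares every
codeword's output law with the law at zero input, at relative entropy `‖x‖² / Nb`
(`log_mul_one_sub_errorProb_le`). For the warden, testing the divergence against a centred multiple
of `∑ yᵢ²` gives `a E / Nw + (n / 2) (a + log (1 - a)) ≤ D` for every `a < 1`
(`energy_le_of_klDiv_ne_top`).

With `a = c / √n`, the second bound reads `E / √n ≤ (Nw / c) (D + c² / 4 + o(1))`. For `D` near `δ`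
the best choice is `c = 2 √δ`, so `E / √n` is asymptotically at most `√δ Nw`, and the first bound
turns this into the claim. -/

/-! ### Variational bounds for relative entropy -/

/-- Young's inequality for the conjugate pair `r log r - r` and `exp`. -/
lemma mul_le_klFun_add_exp {r : ℝ} (hr : 0 ≤ r) (t : ℝ) :
    r * t ≤ klFun r + Real.exp t - 1 := by
  rw [klFun]
  rcases hr.eq_or_lt with rfl | hr
  · simpa using (Real.exp_pos t).le
  · have h := mul_le_mul_of_nonneg_left (Real.add_one_le_exp (t - Real.log r)) hr.le
    rw [Real.exp_sub, Real.exp_log hr, mul_div_cancel₀ _ hr.ne'] at h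
    linarith

/-- A linear form of the Donsker–Varadhan variational bound. -/
lemma integral_le_toReal_klDiv_add_integral_exp {α : Type*} [MeasurableSpace α]
    {μ ν : Measure α} [IsProbabilityMeasure μ] [IsProbabilityMeasure ν]
    (h : klDiv μ ν ≠ ∞) {f : α → ℝ} (hf : Integrable f μ)
    (hexp : Integrable (fun x => Real.exp (f x)) ν) :
    ∫ x, f x ∂μ ≤ (klDiv μ ν).toReal + ∫ x, Real.exp (f x) ∂ν - 1 := by
  obtain ⟨hac, hint⟩ := klDiv_ne_top_iff.1 h
  have hkl : Integrable (fun x => klFun (μ.rnDeriv ν x).toReal) ν :=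
    (integrable_klFun_rnDeriv_iff hac).2 hint
  rw [toReal_klDiv_eq_integral_klFun hac, ← integral_rnDeriv_smul hac]
  calc ∫ x, (μ.rnDeriv ν x).toReal • f x ∂ν
      ≤ ∫ x, (klFun (μ.rnDeriv ν x).toReal + Real.exp (f x) - 1) ∂ν :=
        integral_mono ((integrable_rnDeriv_smul_iff hac).2 hf)
          ((hkl.add hexp).sub (integrable_const 1))
          fun x => mul_le_klFun_add_exp ENNReal.toReal_nonneg (f x)
    _ = _ := by
        have hadd : Integrable (fun x => klFun (μ.rnDeriv ν x).toReal + Real.exp (f x)) ν :=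
          hkl.add hexp
        rw [integral_sub hadd (integrable_const 1), integral_add hkl hexp]
        simp

/-- With the explicit log-density `l`, the integral of `l` under `μ` serves directly as the relative
entropy. The bound integrates `exp f ≥ exp l * (1 + f - l)` against `ν`. -/
lemma integral_le_integral_add_integral_exp_of_withDensity {α : Type*} [MeasurableSpace α]
    {μ ν : Measure α} [IsProbabilityMeasure μ] [IsProbabilityMeasure ν] {l : α → ℝ}
    (hl : Measurable l) (hμ : μ = ν.withDensity fun x => ENNReal.ofReal (Real.exp (l x)))
    (hlint : Integrable l μ) {f : α → ℝ} (hf : Integrable f μ)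
    (hexp : Integrable (fun x => Real.exp (f x)) ν) :
    ∫ x, f x ∂μ ≤ ∫ x, l x ∂μ + ∫ x, Real.exp (f x) ∂ν - 1 := by
  have hm : Measurable fun x => ENNReal.ofReal (Real.exp (l x)) := by fun_prop
  have hlt : ∀ᵐ x ∂ν, ENNReal.ofReal (Real.exp (l x)) < ∞ := by simp
  have hreal (x : α) : (ENNReal.ofReal (Real.exp (l x))).toReal = Real.exp (l x) :=
    ENNReal.toReal_ofReal (Real.exp_pos _).le
  have hone : Integrable (fun x => Real.exp (l x)) ν := by
    have h : Integrable (fun _ => (1 : ℝ)) μ := integrable_const 1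
    rw [hμ, integrable_withDensity_iff_integrable_smul' hm hlt] at h
    simpa [hreal] using h
  have hint : ∫ x, Real.exp (l x) ∂ν = 1 := by
    have h : ∫ _, (1 : ℝ) ∂μ = 1 := by simp
    rw [hμ, integral_withDensity_eq_integral_toReal_smul hm hlt] at h
    simpa [hreal] using h
  have hsub : Integrable (fun x => Real.exp (l x) * (f x - l x)) ν := by
    have h := hf.sub hlint
    rw [hμ, integrable_withDensity_iff_integrable_smul' hm hlt] at h
    simpa [hreal] using h
  have hle : ∫ x, (f x - l x) ∂μ ≤ ∫ x, Real.exp (f x) ∂ν - 1 := by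
    rw [← hint, ← integral_sub hexp hone, hμ,
      integral_withDensity_eq_integral_toReal_smul hm hlt]
    simp only [hreal, smul_eq_mul]
    refine integral_mono hsub (hexp.sub hone) fun x => ?_
    have h := mul_le_mul_of_nonneg_left (Real.add_one_le_exp (f x - l x)) (Real.exp_pos (l x)).le
    rw [← Real.exp_add, add_sub_cancel] at h
    simp only
    linarith
  rw [integral_sub hf hlint] at hle
  linarith

/-! ### Gaussian densities and moments -/

lemma pi_withDensity_ofReal {ι : Type*} [Fintype ι] {E : ι → Type*}
    [∀ i, MeasurableSpace (E i)] (μ : ∀ i, Measure (E i)) [∀ i, SigmaFinite (μ i)]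
    {g : ∀ i, E i → ℝ} (hg : ∀ i, Integrable (g i) (μ i)) (hg0 : ∀ i y, 0 ≤ g i y) :
    Measure.pi (fun i => (μ i).withDensity fun y => ENNReal.ofReal (g i y)) =
      (Measure.pi μ).withDensity fun y => ENNReal.ofReal (∏ i, g i (y i)) := by
  have (i : ι) : IsFiniteMeasure ((μ i).withDensity fun y => ENNReal.ofReal (g i y)) :=
    isFiniteMeasure_withDensity_ofReal (hg i).2
  refine Measure.pi_eq fun s hs => ?_
  rw [withDensity_apply _ (MeasurableSet.univ_pi hs), Measure.restrict_pi_pi,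
    ← ofReal_integral_eq_lintegral_ofReal, integral_fintype_prod_eq_prod,
    ENNReal.ofReal_prod_of_nonneg]
  · refine Finset.prod_congr rfl fun i _ => ?_
    rw [withDensity_apply _ (hs i), ← ofReal_integral_eq_lintegral_ofReal (hg i).restrict
      (Eventually.of_forall (hg0 i))]
  · exact fun i _ => integral_nonneg (hg0 i)
  · exact Integrable.fintype_prod_dep fun i => (hg i).restrict
  · exact Eventually.of_forall fun y => Finset.prod_nonneg fun i _ => hg0 i _

lemma gaussianReal_eq_withDensity_gaussianReal_zero (x : ℝ) {v : ℝ≥0} (hv : v ≠ 0) :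
    gaussianReal x v = (gaussianReal 0 v).withDensity fun y =>
      ENNReal.ofReal (Real.exp ((x * y - x ^ 2 / 2) / v)) := by
  have hv' : (v : ℝ) ≠ 0 := by exact_mod_cast hv
  rw [gaussianReal_of_var_ne_zero _ hv, gaussianReal_of_var_ne_zero _ hv,
    ← withDensity_mul _ (measurable_gaussianPDF _ _) (by fun_prop)]
  congr 1
  ext y
  simp only [gaussianPDF, gaussianPDFReal, Pi.mul_apply]
  rw [← ENNReal.ofReal_mul (by positivity), mul_assoc (√(2 * Real.pi * v))⁻¹,
    ← Real.exp_add]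
  congr 3
  field_simp
  ring

lemma integrable_exp_gaussianReal_zero (x : ℝ) (v : ℝ≥0) :
    Integrable (fun y => Real.exp ((x * y - x ^ 2 / 2) / v)) (gaussianReal 0 v) := by
  refine ((integrable_exp_mul_gaussianReal (x / v)).mul_const
    (Real.exp (-(x ^ 2 / 2 / v)))).congr (Eventually.of_forall fun y => ?_)
  simp only
  rw [← Real.exp_add]
  ring_nf

lemma integrable_sq_gaussianReal (x : ℝ) (v : ℝ≥0) :
    Integrable (fun y => y ^ 2) (gaussianReal x v) :=
  (memLp_id_gaussianReal 2).integrable_sq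

lemma integrable_id_gaussianReal (x : ℝ) (v : ℝ≥0) :
    Integrable (fun y => y) (gaussianReal x v) :=
  (memLp_id_gaussianReal 1).integrable (by simp)

lemma integral_sq_gaussianReal (x : ℝ) (v : ℝ≥0) :
    ∫ y, y ^ 2 ∂gaussianReal x v = v + x ^ 2 := by
  have h := variance_eq_sub (memLp_id_gaussianReal (μ := x) (v := v) 2)
  simp only [variance_id_gaussianReal, Pi.pow_apply, id, integral_id_gaussianReal] at h
  linarith

/-- The tilt turns the Gaussian density into an unnormalized one of variance `v / (1 - a)`, whence
the condition `a < 1`. -/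
lemma integral_exp_mul_sq_gaussianReal {v : ℝ≥0} (hv : v ≠ 0) {a : ℝ} (ha : a < 1) :
    Integrable (fun y => Real.exp (a / (2 * v) * y ^ 2)) (gaussianReal 0 v) ∧
      ∫ y, Real.exp (a / (2 * v) * y ^ 2) ∂gaussianReal 0 v = (√(1 - a))⁻¹ := by
  have hv' : (0 : ℝ) < v := by exact_mod_cast pos_iff_ne_zero.2 hv
  have hb : 0 < (1 - a) / (2 * v) := by have := sub_pos.2 ha; positivity
  have hfun (y : ℝ) : gaussianPDFReal 0 v y * Real.exp (a / (2 * v) * y ^ 2) =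
      (√(2 * Real.pi * v))⁻¹ * Real.exp (-((1 - a) / (2 * v)) * y ^ 2) := by
    rw [gaussianPDFReal, mul_assoc, ← Real.exp_add]
    congr 2
    field_simp
    ring
  constructor
  · rw [gaussianReal_of_var_ne_zero _ hv, integrable_withDensity_iff_integrable_smul'
      (measurable_gaussianPDF _ _) (Eventually.of_forall fun _ => gaussianPDF_lt_top)]
    simp only [toReal_gaussianPDF, smul_eq_mul, hfun]
    exact (integrable_exp_neg_mul_sq hb).const_mul _
  · rw [integral_gaussianReal_eq_integral_smul hv]
    simp only [smul_eq_mul, hfun]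
    rw [integral_const_mul, integral_gaussian, ← Real.sqrt_inv, ← Real.sqrt_inv,
      ← Real.sqrt_mul (by positivity)]
    congr 1
    have := (sub_pos.2 ha).ne'
    have := Real.pi_pos.ne'
    field_simp

/-! ### The memoryless Gaussian channel -/

instance {N : ℝ} {n : ℕ} (x : Fin n → ℝ) : IsProbabilityMeasure (channelLaw N x) := by
  unfold channelLaw
  infer_instance

lemma integrable_eval_channelLaw {N : ℝ} {n : ℕ} (x : Fin n → ℝ) (i : Fin n) {g : ℝ → ℝ}
    (hg : Integrable g (gaussianReal (x i) (N / 2).toNNReal)) :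
    Integrable (fun y => g (y i)) (channelLaw N x) :=
  (measurePreserving_eval (fun i => gaussianReal (x i) (N / 2).toNNReal)
    i).integrable_comp_of_integrable hg

lemma integral_eval_channelLaw {N : ℝ} {n : ℕ} (x : Fin n → ℝ) (i : Fin n) {g : ℝ → ℝ}
    (hg : Integrable g (gaussianReal (x i) (N / 2).toNNReal)) :
    ∫ y, g (y i) ∂channelLaw N x = ∫ t, g t ∂gaussianReal (x i) (N / 2).toNNReal := by
  have h := (measurePreserving_eval (fun i => gaussianReal (x i) (N / 2).toNNReal) i)
  rw [← h.map_eq] at hg ⊢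
  rw [integral_map h.measurable.aemeasurable hg.aestronglyMeasurable]
  rfl

lemma channelLaw_eq_withDensity {N : ℝ} (hN : 0 < N) {n : ℕ} (x : Fin n → ℝ) :
    channelLaw N x = (channelLaw N 0).withDensity fun y =>
      ENNReal.ofReal (Real.exp (∑ i, (x i * y i - x i ^ 2 / 2) / (N / 2))) := by
  have hv : (N / 2).toNNReal ≠ 0 := by simpa using hN
  have hc : ((N / 2).toNNReal : ℝ) = N / 2 := Real.coe_toNNReal _ (by positivity)
  have hint (i : Fin n) := integrable_exp_gaussianReal_zero (x i) (N / 2).toNNReal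
  simp only [hc] at hint
  simp only [channelLaw, gaussianReal_eq_withDensity_gaussianReal_zero (x _) hv, Pi.zero_apply,
    Real.exp_sum, hc]
  exact pi_withDensity_ofReal _ hint fun i y => (Real.exp_pos _).le

/-- Changing the input of the channel from `0` to `x` costs `‖x‖² / N` in relative entropy; this is
the resulting bound on the probability of an event, weighted by `log t`. -/
lemma log_mul_channelLaw_real_le {N : ℝ} (hN : 0 < N) {n : ℕ} (x : Fin n → ℝ)
    {D : Set (Fin n → ℝ)} (hD : MeasurableSet D) {t : ℝ} (ht : 0 < t) :
    Real.log t * (channelLaw N x).real D ≤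
      (∑ i, x i ^ 2) / N + (t - 1) * (channelLaw N 0).real D := by
  have hterm (i : Fin n) : Integrable (fun s => (x i * s - x i ^ 2 / 2) / (N / 2))
      (gaussianReal (x i) (N / 2).toNNReal) :=
    (((integrable_id_gaussianReal _ _).const_mul _).sub (integrable_const _)).div_const _
  have hl : Integrable (fun y => ∑ i, (x i * y i - x i ^ 2 / 2) / (N / 2)) (channelLaw N x) :=
    integrable_finsetSum _ fun i _ => integrable_eval_channelLaw x i (hterm i)
  have hli : ∫ y, ∑ i, (x i * y i - x i ^ 2 / 2) / (N / 2) ∂channelLaw N x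
      = (∑ i, x i ^ 2) / N := by
    rw [integral_finsetSum _ fun i _ => integrable_eval_channelLaw x i (hterm i), Finset.sum_div]
    refine Finset.sum_congr rfl fun i _ => ?_
    rw [integral_eval_channelLaw x i (hterm i), integral_div, integral_sub
      ((integrable_id_gaussianReal _ _).const_mul _) (integrable_const _), integral_const_mul]
    have h := integral_id_gaussianReal (μ := x i) (v := (N / 2).toNNReal)
    rw [h]
    simp only [integral_const, probReal_univ, smul_eq_mul]
    field_simp
    ring
  -- The test function is `log t` on `D` and `0` elsewhere, so its exponential is `t` on `D` and `1`
  -- elsewhere.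
  have hexp : (fun y => Real.exp (D.indicator (fun _ => Real.log t) y)) =
      fun y => 1 + D.indicator (fun _ => t - 1) y := by
    ext y
    by_cases hy : y ∈ D <;> simp [hy, Real.exp_log ht]
  have hind (P : Measure (Fin n → ℝ)) [IsProbabilityMeasure P] (c : ℝ) :
      Integrable (D.indicator fun _ => c) P := (integrable_const c).indicator hD
  have h := integral_le_integral_add_integral_exp_of_withDensity (by fun_prop)
    (channelLaw_eq_withDensity hN x) hl (hind _ (Real.log t))
    (by rw [hexp]; exact (integrable_const 1).add (hind _ _))
  rw [hli, hexp, integral_add (integrable_const 1) (hind _ _), integral_indicator_const _ hD,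
    integral_indicator_const _ hD] at h
  simp only [integral_const, probReal_univ, smul_eq_mul] at h
  linarith

/-! ### Reliability: message rate bounded by energy -/

namespace Code

variable {n : ℕ} (C : Code n)

/-- The total energy of a codeword, averaged over messages and keys. -/
noncomputable def energy : ℝ :=
  (1 / ((C.M : ℝ) * C.K)) * ∑ m, ∑ s, ∑ i, C.codeword m s i ^ 2

/-- Fano's inequality for a fixed key, with mutual information bounded by transmitted energy. -/
lemma log_mul_one_sub_messageError_le {Nb : ℝ} (hNb : 0 < Nb) (s : Fin C.K) :
    Real.log C.M * (1 - C.messageError Nb s) ≤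
      (1 / (C.M : ℝ)) * ∑ m, (∑ i, C.codeword m s i ^ 2) / Nb + 1 := by
  have hM : (0 : ℝ) < C.M := by exact_mod_cast C.M_pos
  have hM1 : (1 : ℝ) ≤ C.M := by exact_mod_cast C.M_pos
  let D (m : Fin C.M) : Set (Fin n → ℝ) := {y | C.decoder s y = some m.succ}
  have hD (m : Fin C.M) : MeasurableSet (D m) := C.measurableSet_decoder s _
  have hdisj : Pairwise (Function.onFun Disjoint D) := by
    intro m m' hm
    refine Set.disjoint_left.2 fun y (hy : _ = _) (hy' : _ = _) => hm ?_
    simpa using hy.symm.trans hy'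
  have hsum : ∑ m, (channelLaw Nb (0 : Fin n → ℝ)).real (D m) ≤ 1 := by
    rw [← measureReal_iUnion_fintype hdisj hD]
    exact measureReal_le_one
  have herr : C.messageError Nb s =
      1 - (1 / (C.M : ℝ)) * ∑ m, (channelLaw Nb (C.codeword m s)).real (D m) := by
    have (m : Fin C.M) : (channelLaw Nb (C.codeword m s)).real {y | C.decoder s y ≠ some m.succ}
        = 1 - (channelLaw Nb (C.codeword m s)).real (D m) :=
      probReal_compl_eq_one_sub (hD m)
    simp only [messageError, this, Finset.sum_sub_distrib]
    simp only [Finset.sum_const, Finset.card_univ, Fintype.card_fin, nsmul_eq_mul]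
    field_simp
  -- The weight `t = M` balances the two terms: the disjoint decoding regions have total mass at
  -- most one under the zero-input law, so after averaging over messages the cost is at most `1`.
  have hmain := Finset.sum_le_sum fun m (_ : m ∈ Finset.univ) =>
    log_mul_channelLaw_real_le hNb (C.codeword m s) (hD m) hM
  rw [← Finset.mul_sum, Finset.sum_add_distrib, ← Finset.mul_sum] at hmain
  have hle : ((C.M : ℝ) - 1) * ∑ m, (channelLaw Nb (0 : Fin n → ℝ)).real (D m) ≤ C.M :=
    (mul_le_of_le_one_right (by linarith) hsum).trans (by linarith)
  have h := mul_le_mul_of_nonneg_left (hmain.trans (add_le_add_right hle _))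
    (one_div_pos.2 hM).le
  rw [mul_add, one_div_mul_cancel hM.ne'] at h
  rw [herr]
  linarith

lemma messageError_le_errorProb (Nb : ℝ) (s : Fin C.K) :
    C.messageError Nb s ≤ C.errorProb Nb := by
  have h := le_ciSup (Set.finite_range (C.messageError Nb)).bddAbove s
  have h0 : 0 ≤ C.silenceError Nb := by unfold silenceError; positivity
  unfold errorProb
  linarith

/-- The bound for a fixed key is averaged over keys, since only the energy averaged over both
messages and keys is controlled by the warden. -/
lemma log_mul_one_sub_errorProb_le {Nb : ℝ} (hNb : 0 < Nb) :
    Real.log C.M * (1 - C.errorProb Nb) ≤ C.energy / Nb + 1 := by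
  have hM : (0 : ℝ) < C.M := by exact_mod_cast C.M_pos
  have hK : (0 : ℝ) < C.K := by exact_mod_cast C.K_pos
  have hlog : 0 ≤ Real.log C.M := Real.log_natCast_nonneg _
  have h := Finset.sum_le_sum fun s (_ : s ∈ (Finset.univ : Finset (Fin C.K))) =>
    (mul_le_mul_of_nonneg_left (sub_le_sub_left (C.messageError_le_errorProb Nb s) 1) hlog).trans
      (C.log_mul_one_sub_messageError_le hNb s)
  rw [Finset.sum_add_distrib, ← Finset.mul_sum, ← Finset.mul_sum, Finset.sum_comm] at h
  simp only [Finset.sum_const, Finset.card_univ, Fintype.card_fin, nsmul_eq_mul,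
    ← Finset.sum_div] at h
  have hE : C.energy / Nb + 1 =
      (1 / (C.M : ℝ) * ((∑ m, ∑ s, ∑ i, C.codeword m s i ^ 2) / Nb) + C.K * 1) / C.K := by
    unfold energy
    field_simp
  rw [hE, le_div_iff₀ hK]
  linarith

/-! ### Covertness: energy bounded by divergence -/

lemma integral_wardenLaw {Nw : ℝ} {f : (Fin n → ℝ) → ℝ}
    (hf : ∀ m s, Integrable f (channelLaw Nw (C.codeword m s))) :
    ∫ y, f y ∂C.wardenLaw Nw =
      (1 / ((C.M : ℝ) * C.K)) * ∑ m, ∑ s, ∫ y, f y ∂channelLaw Nw (C.codeword m s) := by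
  rw [wardenLaw, integral_smul_measure, integral_finsetSum_measure fun m _ =>
    integrable_finsetSum_measure.2 fun s _ => hf m s]
  simp only [integral_finsetSum_measure fun s _ => hf _ s]
  simp

lemma integrable_wardenLaw {Nw : ℝ} {f : (Fin n → ℝ) → ℝ}
    (hf : ∀ m s, Integrable f (channelLaw Nw (C.codeword m s))) :
    Integrable f (C.wardenLaw Nw) := by
  have hM : (C.M : ℝ≥0∞) ≠ 0 := by exact_mod_cast C.M_pos.ne'
  have hK : (C.K : ℝ≥0∞) ≠ 0 := by exact_mod_cast C.K_pos.ne'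
  exact (integrable_finsetSum_measure.2 fun m _ =>
    integrable_finsetSum_measure.2 fun s _ => hf m s).smul_measure
      (ENNReal.inv_ne_top.2 (mul_ne_zero hM hK))

instance (Nw : ℝ) : IsProbabilityMeasure (C.wardenLaw Nw) := by
  have hM : (C.M : ℝ≥0∞) ≠ 0 := by exact_mod_cast C.M_pos.ne'
  have hK : (C.K : ℝ≥0∞) ≠ 0 := by exact_mod_cast C.K_pos.ne'
  constructor
  simp only [wardenLaw, Measure.smul_apply, Measure.coe_finsetSum, Finset.sum_apply,
    measure_univ, smul_eq_mul, Finset.sum_const, Finset.card_univ, Fintype.card_fin,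
    nsmul_eq_mul, mul_one]
  exact ENNReal.inv_mul_cancel (mul_ne_zero hM hK)
    (ENNReal.mul_ne_top (ENNReal.natCast_ne_top _) (ENNReal.natCast_ne_top _))

/-- Among output laws of given second moment the Gaussian one is closest to the silent law; `a` is
the (free) tilting parameter of the variational bound. -/
lemma energy_le_of_klDiv_ne_top {Nw : ℝ} (hNw : 0 < Nw)
    (h : klDiv (C.wardenLaw Nw) (silentLaw Nw n) ≠ ∞) {a : ℝ} (ha : a < 1) :
    a / Nw * C.energy + n / 2 * (a + Real.log (1 - a)) ≤
      (klDiv (C.wardenLaw Nw) (silentLaw Nw n)).toReal := by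
  have hM : (0 : ℝ) < C.M := by exact_mod_cast C.M_pos
  have hK : (0 : ℝ) < C.K := by exact_mod_cast C.K_pos
  have hv : (Nw / 2).toNNReal ≠ 0 := by simpa using hNw
  have hc : ((Nw / 2).toNNReal : ℝ) = Nw / 2 := Real.coe_toNNReal _ (by positivity)
  have h1a : 0 < 1 - a := sub_pos.2 ha
  obtain ⟨hei, hee⟩ := integral_exp_mul_sq_gaussianReal hv ha
  have hNN : 2 * ((Nw / 2).toNNReal : ℝ) = Nw := by rw [hc]; ring
  rw [hNN] at hei hee
  -- This constant normalizes `exp f` to integral one under the silent law, so the linear form of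
  -- the variational bound loses nothing against the logarithmic one.
  set b : ℝ := n / 2 * Real.log (1 - a) with hb
  have hexpb : Real.exp b = √(1 - a) ^ n := by
    rw [hb, ← Real.exp_log (Real.sqrt_pos.2 h1a), ← Real.exp_nat_mul, Real.log_sqrt h1a.le]
    congr 1
    ring
  let f (y : Fin n → ℝ) : ℝ := ∑ i, a / Nw * y i ^ 2 + b
  have hexpf : (fun y => Real.exp (f y)) =
      fun y => (∏ i, Real.exp (a / Nw * y i ^ 2)) * Real.exp b := by
    ext y
    rw [Real.exp_add, Real.exp_sum]
  have hint : Integrable (fun y => Real.exp (f y)) (silentLaw Nw n) := by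
    rw [hexpf]
    exact (Integrable.fintype_prod fun _ => hei).mul_const _
  have hval : ∫ y, Real.exp (f y) ∂silentLaw Nw n = 1 := by
    rw [hexpf, integral_mul_const, silentLaw, channelLaw]
    simp only [Pi.zero_apply]
    rw [integral_fintype_prod_eq_pow (fun t => Real.exp (a / Nw * t ^ 2)), hee, hexpb,
      Fintype.card_fin, ← mul_pow, inv_mul_cancel₀ (Real.sqrt_pos.2 h1a).ne', one_pow]
  have hsq (x : Fin n → ℝ) (i : Fin n) :
      Integrable (fun y => a / Nw * y i ^ 2) (channelLaw Nw x) :=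
    integrable_eval_channelLaw x i ((integrable_sq_gaussianReal _ _).const_mul (a / Nw))
  have hfi (x : Fin n → ℝ) : Integrable f (channelLaw Nw x) :=
    (integrable_finsetSum _ fun i _ => hsq x i).add (integrable_const b)
  have hfv (x : Fin n → ℝ) : ∫ y, f y ∂channelLaw Nw x =
      a / Nw * ∑ i, x i ^ 2 + n / 2 * a + b := by
    rw [integral_add (integrable_finsetSum _ fun i _ => hsq x i) (integrable_const b),
      integral_finsetSum _ fun i _ => hsq x i]
    simp only [integral_eval_channelLaw x _ ((integrable_sq_gaussianReal _ _).const_mul (a / Nw)),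
      integral_const_mul, integral_sq_gaussianReal, hc, ← Finset.mul_sum, Finset.sum_add_distrib]
    simp only [Finset.sum_const, Finset.card_univ, Fintype.card_fin, nsmul_eq_mul, integral_const,
      probReal_univ, smul_eq_mul]
    field_simp
    ring
  have : IsProbabilityMeasure (silentLaw Nw n) := by unfold silentLaw; infer_instance
  have key := integral_le_toReal_klDiv_add_integral_exp h
    (C.integrable_wardenLaw fun m s => hfi _) hint
  rw [hval, C.integral_wardenLaw fun m s => hfi _] at key
  simp only [hfv, Finset.sum_add_distrib, ← Finset.mul_sum, Finset.sum_const, Finset.card_univ,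
    Fintype.card_fin, nsmul_eq_mul] at key
  refine le_trans (le_of_eq ?_) (key.trans_eq (by ring))
  unfold energy
  field_simp
  ring

end Code

/-! ### Tilting at scale `1 / √n` -/

/-- Second-order Taylor bound; the remainder `a³ / (1 - a)` is at most `2 a³` because `a ≤ 1 / 2`.
-/
lemma neg_sub_sq_sub_cube_le_log_one_sub {a : ℝ} (h0 : 0 ≤ a) (h1 : a ≤ 1 / 2) :
    -(a ^ 2 / 2) - 2 * a ^ 3 ≤ a + Real.log (1 - a) := by
  have h := (abs_le.1 (Real.abs_log_sub_add_sum_range_le (x := a)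
    (by rw [abs_of_nonneg h0]; linarith) 2)).1
  rw [abs_of_nonneg h0] at h
  have h2 : a ^ (2 + 1) / (1 - a) ≤ 2 * a ^ 3 := by
    rw [div_le_iff₀ (by linarith)]
    have h3 : 0 ≤ a ^ 3 * (1 - 2 * a) := mul_nonneg (pow_nonneg h0 3) (by linarith)
    calc a ^ (2 + 1) ≤ a ^ (2 + 1) + a ^ 3 * (1 - 2 * a) := le_add_of_nonneg_right h3
      _ = 2 * a ^ 3 * (1 - a) := by ring
  simp only [Finset.sum_range_succ, Finset.sum_range_zero] at h
  norm_num at h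
  norm_num at h2
  linarith

namespace Code

variable {n : ℕ} (C : Code n)

/-- The square root law: the energy of a code is at most of order `√n`. -/
lemma energy_div_sqrt_le {Nw : ℝ} (hNw : 0 < Nw)
    (h : klDiv (C.wardenLaw Nw) (silentLaw Nw n) ≠ ∞) (hn : 0 < n) {c : ℝ} (hc : 0 < c)
    (hcn : c / √n ≤ 1 / 2) :
    C.energy / √n ≤ Nw / c *
      ((klDiv (C.wardenLaw Nw) (silentLaw Nw n)).toReal + c ^ 2 / 4 + c ^ 3 / √n) := by
  have hs : 0 < √(n : ℝ) := Real.sqrt_pos.2 (by exact_mod_cast hn)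
  have hsq : (n : ℝ) = √n ^ 2 := (Real.sq_sqrt (by positivity)).symm
  have h1 := C.energy_le_of_klDiv_ne_top hNw h (a := c / √n) (by linarith)
  have h2 := mul_le_mul_of_nonneg_left
    (neg_sub_sq_sub_cube_le_log_one_sub (by positivity) hcn) (show (0 : ℝ) ≤ n / 2 by positivity)
  -- At `a = c / √n` the quadratic term survives as `c² / 4`, while the cubic one decays as `c³ /
  -- √n`.
  have h3 : (n : ℝ) / 2 * (-((c / √n) ^ 2 / 2) - 2 * (c / √n) ^ 3) =
      -(c ^ 2 / 4 + c ^ 3 / √n) := by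
    nth_rewrite 1 [hsq]
    field_simp
    ring
  have h4 : C.energy / √n = Nw / c * (c / √n / Nw * C.energy) := by field_simp
  rw [h4]
  gcongr
  linarith

end Code

end CovertComm

/-! ### Passage to the limit -/

open CovertComm

theorem theorem4 (Nw Nb : ℝ) (hNw : 0 < Nw) (hNb : 0 < Nb)
    (δ : ℝ) (hδ0 : 0 < δ) (hδ1 : δ < 1)
    (n : ℕ → ℕ) (hn : Tendsto n atTop atTop)
    (C : ∀ k : ℕ, CovertComm.Code (n k))
    (herr : Tendsto (fun k => (C k).errorProb Nb) atTop (𝓝 0))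
    (hkl : limsup (fun k => klDiv ((C k).wardenLaw Nw) (CovertComm.silentLaw Nw (n k))) atTop
      ≤ ENNReal.ofReal δ) :
    limsup (fun k => ((Real.log ((C k).M : ℝ) / Real.sqrt (n k : ℝ) : ℝ) : EReal)) atTop
      ≤ ((Real.sqrt δ * Nw / Nb : ℝ) : EReal) := by
  have hδs : 0 < √δ := Real.sqrt_pos.2 hδ0
  have hsqrt : Tendsto (fun k => √(n k : ℝ)) atTop atTop :=
    Real.tendsto_sqrt_atTop.comp (tendsto_natCast_atTop_atTop.comp hn)
  -- This value minimizes `(δ + c² / 4) / c`, making both summands equal to `δ`.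
  set c : ℝ := 2 * √δ with hcdef
  have hc : 0 < c := by positivity
  have hcsq : c ^ 2 / 4 = δ := by rw [hcdef, mul_pow, Real.sq_sqrt hδ0.le]; ring
  let U (d : ℝ) (k : ℕ) : ℝ :=
    (Nw / c * (d + δ + c ^ 3 / √(n k : ℝ)) / Nb + 1 / √(n k : ℝ)) / (1 - (C k).errorProb Nb)
  have hU (d : ℝ) : Tendsto (U d) atTop (𝓝 (Nw / c * (d + δ) / Nb)) := by
    have h : Tendsto (U d) atTop (𝓝 ((Nw / c * (d + δ + 0) / Nb + 0) / (1 - 0))) :=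
      (((((hsqrt.const_div_atTop _).const_add _).const_mul _).div_const _).add
        (hsqrt.const_div_atTop _)).div (herr.const_sub 1) (by norm_num)
    simpa using h
  have hbound {d : ℝ} (hd : δ < d) :
      ∀ᶠ k in atTop, Real.log ((C k).M : ℝ) / √(n k : ℝ) ≤ U d k := by
    -- The limsup hypothesis bounds the divergence eventually only by a `d > δ`, which also makes it
    -- finite; `d` decreases to `δ` at the end.
    have hlim : ∀ᶠ k in atTop,
        klDiv ((C k).wardenLaw Nw) (silentLaw Nw (n k)) < ENNReal.ofReal d :=
      eventually_lt_of_limsup_lt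
        (hkl.trans_lt ((ENNReal.ofReal_lt_ofReal_iff (hδ0.trans hd)).2 hd))
    filter_upwards [hlim, hn.eventually_gt_atTop 0, herr.eventually_lt_const one_pos,
      (hsqrt.const_div_atTop c).eventually_le_const (show (0 : ℝ) < 1 / 2 by norm_num)]
      with k hk hnk hek hck
    have hs : 0 < √(n k : ℝ) := Real.sqrt_pos.2 (by exact_mod_cast hnk)
    have hkd := ENNReal.toReal_le_of_le_ofReal (hδ0.trans hd).le hk.le
    have h1 := (C k).energy_div_sqrt_le hNw hk.ne_top hnk hc hck
    have h2 := (C k).log_mul_one_sub_errorProb_le hNb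
    rw [hcsq] at h1
    rw [le_div_iff₀ (sub_pos.2 hek)]
    calc Real.log ((C k).M : ℝ) / √(n k : ℝ) * (1 - (C k).errorProb Nb)
        = Real.log ((C k).M : ℝ) * (1 - (C k).errorProb Nb) / √(n k : ℝ) := by ring
      _ ≤ ((C k).energy / Nb + 1) / √(n k : ℝ) := by gcongr
      _ = (C k).energy / √(n k : ℝ) / Nb + 1 / √(n k : ℝ) := by ring
      _ ≤ _ := by
        gcongr
        refine h1.trans ?_
        gcongr
  have htarget : Nw / c * (δ + δ) / Nb = √δ * Nw / Nb := by
    rw [hcdef]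
    nth_rewrite 2 [← Real.sq_sqrt hδ0.le]
    nth_rewrite 3 [← Real.sq_sqrt hδ0.le]
    field_simp
    norm_num
  have hlimit {d : ℝ} (hd : δ < d) :
      limsup (fun k => ((Real.log ((C k).M : ℝ) / √(n k : ℝ) : ℝ) : EReal)) atTop ≤
        ((Nw / c * (d + δ) / Nb : ℝ) : EReal) := by
    have ht : Tendsto (fun k => (U d k : EReal)) atTop (𝓝 ((Nw / c * (d + δ) / Nb : ℝ) : EReal)) :=
      (continuous_coe_real_ereal.tendsto _).comp (hU d)
    rw [← ht.limsup_eq]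
    exact limsup_le_limsup ((hbound hd).mono fun k hk => EReal.coe_le_coe hk)
  have hright : Tendsto (fun d : ℝ => ((Nw / c * (d + δ) / Nb : ℝ) : EReal)) (𝓝[>] δ)
      (𝓝 ((√δ * Nw / Nb : ℝ) : EReal)) := by
    rw [← htarget]
    refine (continuous_coe_real_ereal.tendsto _).comp (Tendsto.mono_left ?_ nhdsWithin_le_nhds)
    exact Continuous.tendsto (by fun_prop) δ
  exact ge_of_tendsto hright (eventually_mem_nhdsWithin.mono fun d hd => hlimit hd)
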